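/- Fix a (finitary, single-sorted) algebraic signature, and let $\mathbb V$ be a quasi-variety of universal algebras of this signature, i.e. the class of all algebras satisfying some set of quasi-identities $s_1\approx t_1\wedge\dots\wedge s_n\approx t_n\Rightarrow s\approx t$ ($n\ge 0$). A relation $U\subseteq X\times Y$ between algebras $X,Y$ is *compatible* if it is a subalgebra of $X\times Y$; a *congruence* on $X$ is a compatible equivalence relation on $X$. For $X\in\mathbb V$, a relation $P$ on $X$ is *positive* if there are an algebra $Y\in\mathbb V$ and a compatible relation $U\subseteq X\times Y$ such that $P=U^\circ U$, that is, for all $x,x'\in X$: $(x,x')\in P$ if and only if $(x,y)\in U$ and $(x',y)\in U$ for some $y\in Y$. The following conditions are equivalent: 1. $\mathbb V$ is $3$-permutable: $RSR=SRS$ for all congruences $R$ and $S$ on the same algebra $X\in\mathbb V$. 2. The Shifting Lemma holds in $\mathbb V$ when $S$ is a reflexive compatible relation and $R$ and $T$ are reflexive and positive compatible relations: for every $X\in\mathbb V$ and all such relations $R,S,T$ on $X$ with $R\cap S\subseteq T$, whenever $x,y,u,v\in X$ satisfy $(x,y)\in R\cap T$, $(x,u)\in S$, $(y,v)\in S$ and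 $(u,v)\in R$, one has $(u,v)\in T$. -/

import Mathlib

universe u v w

namespace UniversalAlgebra

/-- A quasi-identity `s₁ ≈ t₁ ∧ … ∧ sₙ ≈ tₙ → s ≈ t` (with `n ≥ 0`) between terms of the language
`L` in a countable supply of variables; `n = 0` gives the identities. -/
structure QuasiIdentity (L : FirstOrder.Language.{u, v}) where
  /-- The finitely many equations in the premise. -/
  premises : List (L.Term ℕ × L.Term ℕ)
  /-- The equation in the conclusion. -/
  conclusion : L.Term ℕ × L.Term ℕ

/-- The algebra `A` satisfies the quasi-identity `q`: under every assignment of the variables for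
which all the equations of the premise hold, the equation of the conclusion holds. -/
def QuasiIdentity.Holds {L : FirstOrder.Language.{u, v}} (q : QuasiIdentity L)
    (A : Type w) [L.Structure A] : Prop :=
  ∀ a : ℕ → A, (∀ e ∈ q.premises, e.1.realize a = e.2.realize a) →
    q.conclusion.1.realize a = q.conclusion.2.realize a

/-- A class of algebras is a quasi-variety if it is the class of all algebras that satisfy some set
of quasi-identities. (For an algebraic language `L`, an `L`-structure is a universal algebra of
signature `L`.) -/
def IsQuasiVariety {L : FirstOrder.Language.{u, v}} (V : Set (CategoryTheory.Bundled.{w} L.Structure)) : Prop :=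
  ∃ Q : Set (QuasiIdentity L), V = {A : CategoryTheory.Bundled.{w} L.Structure | ∀ q ∈ Q, q.Holds A}

/-- A relation from `X` to `Y` is compatible if it is preserved by all the basic operations, i.e. if
it is a subalgebra of the product algebra `X × Y`. -/
def IsCompatible (L : FirstOrder.Language.{u, v}) {X Y : Type w} [L.Structure X] [L.Structure Y]
    (U : SetRel X Y) : Prop :=
  ∀ (n : ℕ) (f : L.Functions n) (x : Fin n → X) (y : Fin n → Y),
    (∀ i, (x i, y i) ∈ U) →
      (FirstOrder.Language.Structure.funMap f x, FirstOrder.Language.Structure.funMap f y) ∈ U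

/-- A congruence is a compatible equivalence relation. -/
structure IsCongruence (L : FirstOrder.Language.{u, v}) {X : Type w} [L.Structure X]
    (R : SetRel X X) : Prop where
  compatible : IsCompatible L R
  refl : R.IsRefl
  symm : R.IsSymm
  trans : R.IsTrans

/-- A relation `P` on `X` is positive in the class `V` if `P = U° U` for some algebra `Y` in `V` and
some compatible relation `U` from `X` to `Y`: one has `(x, x') ∈ P` if and only if `(x, y) ∈ U` and
`(x', y) ∈ U` for some `y`. (`SetRel.comp` composes from left to right.) -/
def IsPositive {L : FirstOrder.Language.{u, v}} (V : Set (CategoryTheory.Bundled.{w} L.Structure))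
    {X : Type w} [L.Structure X] (P : SetRel X X) : Prop :=
  ∃ Y ∈ V, ∃ U : SetRel X Y, IsCompatible L U ∧ P = U.comp U.inv

/-- `V` is 3-permutable: `R S R = S R S` for all congruences `R`, `S` on an algebra of `V`. -/
def IsThreePermutable {L : FirstOrder.Language.{u, v}} (V : Set (CategoryTheory.Bundled.{w} L.Structure)) : Prop :=
  ∀ X ∈ V, ∀ R S : SetRel X X, IsCongruence L R → IsCongruence L S →
    (R.comp S).comp R = (S.comp R).comp S

/-- The property expressed by the Shifting Lemma for three relations `R`, `S`, `T` on a set: if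
`R ∧ S ≤ T`, then the diagram
```
  x --S-- u
  |       |
 R,T      R   (read from left to right and from top to bottom)
  |       |
  y --S-- v
```
implies `(u, v) ∈ T`. -/
def Shifts {X : Type w} (R S T : SetRel X X) : Prop :=
  R ∩ S ⊆ T → ∀ x y u v : X,
    (x, y) ∈ R ∩ T → (x, u) ∈ S → (y, v) ∈ S → (u, v) ∈ R → (u, v) ∈ T

/-- The Shifting Lemma holds in `V` when `S` is a reflexive compatible relation, and `R` and `T` are
reflexive and positive compatible relations. -/
def PositiveShiftingLemma {L : FirstOrder.Language.{u, v}} (V : Set (CategoryTheory.Bundled.{w} L.Structure)) : Prop :=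
  ∀ X ∈ V, ∀ R S T : SetRel X X,
    IsCompatible L R → R.IsRefl → IsPositive V R →
    IsCompatible L S → S.IsRefl →
    IsCompatible L T → T.IsRefl → IsPositive V T →
    Shifts R S T

end UniversalAlgebra

/-!
Regard a compatible relation `U` from `X` to `Y` as an algebra. Applied to the kernels of its two
projections, 3-permutability gives `U U° U U° ⊆ U U°` (composing in diagrammatic order): the
positive relation `U U°` is transitive. Hence in a 3-permutable class the reflexive positive
relations are congruences. The shift from `(x, y)` to `(u, v)` comes from applying the same
transitivity to a relation from `X × X` to `X` in which `(u, u)` and `(v, v)` are both linked to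
`(x, u)`.

Conversely, for congruences `R` and `S` the relation `R S R = (R S) (R S)°` is positive, and the
Shifting Lemma for the triple `R S R`, `R`, `S R S` yields `R S R ⊆ S R S`.
-/

namespace UniversalAlgebra

open CategoryTheory FirstOrder.Language
open scoped FirstOrder SetRel

section Algebras

variable {L : FirstOrder.Language.{u, v}}

/-- The product of two algebras, with the operations (and any relations) taken coordinatewise. -/
instance prodStructure (X Y : Type w) [L.Structure X] [L.Structure Y] : L.Structure (X × Y) where
  funMap f p := (Structure.funMap f fun i => (p i).1, Structure.funMap f fun i => (p i).2)
  RelMap r p := Structure.RelMap r (fun i => (p i).1) ∧ Structure.RelMap r fun i => (p i).2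

/-- The first projection of a product of algebras, as a homomorphism. -/
def fstHom (X Y : Type w) [L.Structure X] [L.Structure Y] : (X × Y) →[L] X where
  toFun := Prod.fst
  map_rel' _ _ h := h.1

/-- The second projection of a product of algebras, as a homomorphism. -/
def sndHom (X Y : Type w) [L.Structure X] [L.Structure Y] : (X × Y) →[L] Y where
  toFun := Prod.snd
  map_rel' _ _ h := h.2

/-- The kernel congruence of a homomorphism. -/
def kernel {X Y : Type w} [L.Structure X] [L.Structure Y] (f : X →[L] Y) : SetRel X X :=
  {(a, b) | f a = f b}

theorem isCongruence_kernel {X Y : Type w} [L.Structure X] [L.Structure Y] (f : X →[L] Y) :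
    IsCongruence L (kernel f) where
  compatible _ g a b (h : ∀ i, f (a i) = f (b i)) :=
    calc f (Structure.funMap g a) = Structure.funMap g (f ∘ a) := f.map_fun g a
      _ = Structure.funMap g (f ∘ b) := congrArg (Structure.funMap g) (funext h)
      _ = f (Structure.funMap g b) := (f.map_fun g b).symm
  refl := ⟨fun _ => rfl⟩
  symm := ⟨fun _ _ => Eq.symm⟩
  trans := ⟨fun _ _ _ => Eq.trans⟩

end Algebras

namespace IsCompatible

variable {L : FirstOrder.Language.{u, v}} {X Y Z : Type w}
  [L.Structure X] [L.Structure Y] [L.Structure Z]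

theorem inv {U : SetRel X Y} (hU : IsCompatible L U) : IsCompatible L U.inv :=
  fun n f y x h => hU n f x y h

theorem comp {U : SetRel X Y} {W : SetRel Y Z} (hU : IsCompatible L U) (hW : IsCompatible L W) :
    IsCompatible L (U ○ W) := by
  intro n f x z h
  choose y hxy hyz using h
  exact ⟨_, hU n f x y hxy, hW n f y z hyz⟩

theorem inter {U W : SetRel X Y} (hU : IsCompatible L U) (hW : IsCompatible L W) :
    IsCompatible L (U ∩ W) :=
  fun n f x y h => ⟨hU n f x y fun i => (h i).1, hW n f x y fun i => (h i).2⟩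

theorem comap_hom {U : SetRel Y Z} (hU : IsCompatible L U) (g : X →[L] Y) :
    IsCompatible L {(x, z) | g x ~[U] z} := by
  intro n f x z h
  change g (Structure.funMap f x) ~[U] Structure.funMap f z
  rw [g.map_fun]
  exact hU n f (g ∘ x) z h

/-- A compatible relation regarded as a subalgebra of the product. -/
def substructure {U : SetRel X Y} (hU : IsCompatible L U) : L.Substructure (X × Y) where
  carrier := U
  fun_mem f _ h := hU _ f _ _ h

end IsCompatible

variable {L : FirstOrder.Language.{u, v}} {V : Set (Bundled.{w} L.Structure)}

/-- A class of algebras is closed under subalgebras of binary products. It is stated up to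
isomorphism: a subalgebra of `X × Y` is an algebra with a jointly injective pair of homomorphisms to
`X` and `Y`. -/
def IsClosedUnderSubproducts (V : Set (Bundled.{w} L.Structure)) : Prop :=
  ∀ ⦃A X Y : Bundled.{w} L.Structure⦄ (f : A →[L] X) (g : A →[L] Y), X ∈ V → Y ∈ V →
    Function.Injective (fun a => (f a, g a)) → A ∈ V

theorem QuasiIdentity.Holds.map_realize_conclusion {q : QuasiIdentity L} {A X : Type w}
    [L.Structure A] [L.Structure X] (hq : q.Holds X) (f : A →[L] X) {a : ℕ → A}
    (ha : ∀ e ∈ q.premises, e.1.realize a = e.2.realize a) :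
    f (q.conclusion.1.realize a) = f (q.conclusion.2.realize a) := by
  simp only [← HomClass.realize_term]
  refine hq (f ∘ a) fun e he => ?_
  simp only [HomClass.realize_term, ha e he]

theorem IsQuasiVariety.isClosedUnderSubproducts (hV : IsQuasiVariety V) :
    IsClosedUnderSubproducts V := by
  obtain ⟨Q, rfl⟩ := hV
  intro A X Y f g hX hY hfg q hq a ha
  exact hfg (Prod.ext ((hX q hq).map_realize_conclusion f ha)
    ((hY q hq).map_realize_conclusion g ha))

namespace IsClosedUnderSubproducts

theorem prod_mem (hV : IsClosedUnderSubproducts V) {X Y : Bundled.{w} L.Structure}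
    (hX : X ∈ V) (hY : Y ∈ V) : Bundled.of (c := L.Structure) (X × Y) ∈ V :=
  hV (fstHom X Y) (sndHom X Y) hX hY Function.injective_id

theorem substructure_mem (hV : IsClosedUnderSubproducts V) {X Y : Bundled.{w} L.Structure}
    (hX : X ∈ V) (hY : Y ∈ V) (A : L.Substructure (X × Y)) : Bundled.of (c := L.Structure) A ∈ V :=
  hV ((fstHom X Y).comp A.subtype.toHom) ((sndHom X Y).comp A.subtype.toHom)
    hX hY Subtype.val_injective

end IsClosedUnderSubproducts

theorem IsThreePermutable.isTrans_comp_inv (hV₃ : IsThreePermutable V)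
    (hV : IsClosedUnderSubproducts V) {X Y : Bundled.{w} L.Structure} (hX : X ∈ V) (hY : Y ∈ V)
    {U : SetRel X Y} (hU : IsCompatible L U) : (U ○ U.inv).IsTrans where
  trans := by
    rintro a b c ⟨y, hay, hby⟩ ⟨z, hbz, hcz⟩
    let A := hU.substructure
    let R := kernel ((fstHom X Y).comp A.subtype.toHom)
    let S := kernel ((sndHom X Y).comp A.subtype.toHom)
    have hRS : (R ○ S) ○ R = (S ○ R) ○ S :=
      hV₃ (Bundled.of (c := L.Structure) A) (hV.substructure_mem hX hY A) R S
        (isCongruence_kernel _) (isCongruence_kernel _)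
    have path : (⟨(a, y), hay⟩ : A) ~[(S ○ R) ○ S] ⟨(c, z), hcz⟩ :=
      ⟨⟨(b, z), hbz⟩, ⟨⟨(b, y), hby⟩, rfl, rfl⟩, rfl⟩
    obtain ⟨⟨⟨c', t'⟩, hc't'⟩, ⟨⟨⟨a', t⟩, ha't⟩, haa', htt'⟩, hc'c⟩ := hRS.ge path
    obtain rfl : a = a' := haa'
    obtain rfl : t = t' := htt'
    obtain rfl : c' = c := hc'c
    exact ⟨t, ha't, hc't'⟩

theorem IsPositive.isCongruence {X : Bundled.{w} L.Structure} {P : SetRel X X}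
    (hP : IsPositive V P) (hPr : P.IsRefl) (hV : IsClosedUnderSubproducts V)
    (hV₃ : IsThreePermutable V) (hX : X ∈ V) : IsCongruence L P := by
  obtain ⟨Y, hY, U, hU, rfl⟩ := hP
  exact {
    compatible := hU.comp hU.inv
    refl := hPr
    symm := ⟨fun _ _ ⟨y, hay, hby⟩ => ⟨y, hby, hay⟩⟩
    trans := hV₃.isTrans_comp_inv hV hX hY hU }

theorem IsThreePermutable.shifts (hV₃ : IsThreePermutable V) (hV : IsClosedUnderSubproducts V)
    {X : Bundled.{w} L.Structure} (hX : X ∈ V) {R S T : SetRel X X} (hR : IsCongruence L R)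
    (hS : IsCompatible L S) (hSr : S.IsRefl) (hT : IsCongruence L T) : Shifts R S T := by
  rintro hRST x y u v ⟨hxyR, hxyT⟩ hxu hyv huv
  have := hR.refl; have := hR.symm; have := hR.trans
  have := hT.refl; have := hT.symm; have := hT.trans
  -- The second coordinate keeps the witness of transitivity in the `R`-class of `u`, which is what
  -- makes `R ∩ S ⊆ T` applicable in `hUT`.
  let U : SetRel (X × X) X := {(p, c) | p.1 ~[(R ∩ T) ○ S] c} ∩ {(p, c) | p.2 ~[R] c}
  have hU : IsCompatible L U :=
    (((hR.compatible.inter hT.compatible).comp hS).comap_hom (fstHom X X)).inter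
      (hR.compatible.comap_hom (sndHom X X))
  have hUT {a c : X} : (a, a) ~[U] c → a ~[T] c := by
    rintro ⟨⟨b, ⟨habR, habT⟩, hbc⟩, hac⟩
    have hbcR : b ~[R] c := R.trans (R.symm habR) hac
    exact T.trans habT (hRST ⟨hbcR, hbc⟩)
  have hU_diag (a : X) : (a, a) ~[U] a := ⟨⟨a, ⟨R.rfl, T.rfl⟩, S.rfl⟩, R.rfl⟩
  have hU_xu : (x, u) ~[U] u := ⟨⟨x, ⟨R.rfl, T.rfl⟩, hxu⟩, R.rfl⟩
  have hU_xv : (x, u) ~[U] v := ⟨⟨y, ⟨hxyR, hxyT⟩, hyv⟩, huv⟩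
  obtain ⟨t, hut, hvt⟩ : (u, u) ~[U ○ U.inv] (v, v) :=
    (hV₃.isTrans_comp_inv hV (hV.prod_mem hX hX) hX hU).trans _ _ _
      ⟨u, hU_diag u, hU_xu⟩ ⟨v, hU_xv, hU_diag v⟩
  exact T.trans (hUT hut) (T.symm (hUT hvt))

theorem IsThreePermutable.positiveShiftingLemma (hV₃ : IsThreePermutable V)
    (hV : IsClosedUnderSubproducts V) : PositiveShiftingLemma V :=
  fun _ hX _ _ _ _ hRr hRp hS hSr _ hTr hTp =>
    hV₃.shifts hV hX (hRp.isCongruence hRr hV hV₃ hX) hS hSr (hTp.isCongruence hTr hV hV₃ hX)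

namespace IsCongruence

variable {X : Bundled.{w} L.Structure} {R S : SetRel X X}

theorem isPositive_comp_comp (hR : IsCongruence L R) (hS : IsCongruence L S) (hX : X ∈ V) :
    IsPositive V ((R ○ S) ○ R) := by
  have := hR.symm
  have := hS.refl; have := hS.symm; have := hS.trans
  refine ⟨X, hX, R ○ S, hR.compatible.comp hS.compatible, ?_⟩
  calc (R ○ S) ○ R = (R ○ (S ○ S)) ○ R := by rw [SetRel.comp_eq_self]
    _ = (R ○ S) ○ (S ○ R) := by simp only [SetRel.comp_assoc]
    _ = (R ○ S) ○ (R ○ S).inv := by simp only [SetRel.inv_comp, SetRel.inv_eq_self]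

theorem comp_comp_subset (hR : IsCongruence L R) (hS : IsCongruence L S) (hX : X ∈ V)
    (h : PositiveShiftingLemma V) : (R ○ S) ○ R ⊆ (S ○ R) ○ S := by
  have := hR.refl; have := hR.symm; have := hS.refl
  rintro ⟨u, v⟩ ⟨y, ⟨x, hux, hxy⟩, hyv⟩
  have shift : Shifts ((R ○ S) ○ R) R ((S ○ R) ○ S) :=
    h X hX _ _ _
      ((hR.compatible.comp hS.compatible).comp hR.compatible) inferInstance
      (hR.isPositive_comp_comp hS hX)
      hR.compatible hR.refl
      ((hS.compatible.comp hR.compatible).comp hS.compatible) inferInstance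
      (hS.isPositive_comp_comp hR hX)
  have hR_sub : R ⊆ (S ○ R) ○ S := SetRel.right_subset_comp.trans SetRel.left_subset_comp
  have hS_sub : S ⊆ (R ○ S) ○ R := SetRel.right_subset_comp.trans SetRel.left_subset_comp
  exact shift (Set.inter_subset_right.trans hR_sub) x y u v
    ⟨hS_sub hxy, SetRel.right_subset_comp hxy⟩ (R.symm hux) hyv ⟨y, ⟨x, hux, hxy⟩, hyv⟩

end IsCongruence

theorem PositiveShiftingLemma.isThreePermutable (h : PositiveShiftingLemma V) :
    IsThreePermutable V :=
  fun _ hX _ _ hR hS =>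
    (hR.comp_comp_subset hS hX h).antisymm (hS.comp_comp_subset hR hX h)

end UniversalAlgebra

theorem corollary3p8_general {L : FirstOrder.Language.{u, v}}
    {V : Set (CategoryTheory.Bundled.{w} L.Structure)}
    (hV : UniversalAlgebra.IsClosedUnderSubproducts V) :
    UniversalAlgebra.IsThreePermutable V ↔ UniversalAlgebra.PositiveShiftingLemma V :=
  ⟨fun h => h.positiveShiftingLemma hV, fun h => h.isThreePermutable⟩

theorem corollary3p8 {L : FirstOrder.Language.{u, v}} [L.IsAlgebraic]
    (V : Set (CategoryTheory.Bundled.{w} L.Structure)) (hV : UniversalAlgebra.IsQuasiVariety V) :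
    UniversalAlgebra.IsThreePermutable V ↔ UniversalAlgebra.PositiveShiftingLemma V :=
  corollary3p8_general hV.isClosedUnderSubproducts
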